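/- Let $\mathbb H=\{s\in\mathbb C:\operatorname{Re}s>-\tfrac12\}$ and let $(p_n)_{n\ge 0}$ be a sequence in $\mathbb H$, indexed by $\mathbb N=\{0,1,2,\dots\}$. For scalars $c_n\in\mathbb C$, say that $x^n\mapsto c_nx^{p_n}$ extends boundedly if there is a bounded linear operator $T$ on the complex space $L^2[0,1]$ with $T(x^n)=c_nx^{p_n}$ for every $n\in\mathbb N$. An infinite complex matrix is called positive semidefinite if all its finite principal submatrices are positive semidefinite. (a) There exist scalars $c_n$, all of them non-zero, such that $x^n\mapsto c_nx^{p_n}$ extends boundedly if and only if the infinite matrix $$\left[\frac{p_m+\overline{p_n}+1}{m+n+1}\right]_{m,n\ge 0}$$ is positive semidefinite. (b) If $(c_n)$ is any sequence of scalars (some of which may be zero) for which $x^n\mapsto c_nx^{p_n}$ extends boundedly, then the submatrix of the above matrix with rows and columns in $\{n\in\mathbb N: c_n\neq 0\}$ is positive semidefinite. -/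

import Mathlib

open MeasureTheory

open scoped ComplexOrder

noncomputable section

namespace MonomialOperator

/-- The half plane of exponents: `x ^ s` is square integrable on `[0,1]` iff `-1/2 < re s`. -/
def halfPlane : Set ℂ := {s : ℂ | -1 / 2 < s.re}

/-- Lebesgue measure on `[0,1]`. -/
abbrev unitMeasure : Measure ℝ := volume.restrict (Set.Icc (0 : ℝ) 1)

/-- The complex Hilbert space `L²[0,1]`. -/
abbrev L2 : Type := Lp ℂ 2 unitMeasure

theorem memLp_cpow {s : ℂ} (hs : s ∈ halfPlane) :
    MemLp (fun x : ℝ => (x : ℂ) ^ s) 2 unitMeasure := by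
  have hs' : -1 / 2 < s.re := hs
  have hm : AEStronglyMeasurable (fun x : ℝ => (x : ℂ) ^ s) unitMeasure :=
    (Complex.measurable_ofReal.pow_const s).aestronglyMeasurable
  rw [memLp_two_iff_integrable_sq_norm hm]
  have h1 : IntegrableOn (fun x : ℝ => x ^ (2 * s.re)) (Set.Ioc 0 1) := by
    have := intervalIntegral.intervalIntegrable_rpow' (a := 0) (b := 1)
      (r := 2 * s.re) (by linarith)
    rwa [intervalIntegrable_iff_integrableOn_Ioc_of_le zero_le_one] at this
  change IntegrableOn (fun x : ℝ => ‖(x : ℂ) ^ s‖ ^ 2) (Set.Icc 0 1)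
  rw [integrableOn_Icc_iff_integrableOn_Ioc]
  refine h1.congr_fun (fun x hx => ?_) measurableSet_Ioc
  change x ^ (2 * s.re) = ‖(x : ℂ) ^ s‖ ^ 2
  rw [Complex.norm_cpow_eq_rpow_re_of_pos hx.1, ← Real.rpow_natCast, ← Real.rpow_mul hx.1.le]
  congr 1
  push_cast
  ring

/-- The function `x ↦ x ^ s`, as an element of `L²[0,1]`. -/
def power (s : halfPlane) : L2 := (memLp_cpow s.2).toLp (fun x : ℝ => (x : ℂ) ^ (s : ℂ))

theorem natCast_mem (n : ℕ) : (n : ℂ) ∈ halfPlane := by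
  have h : (0 : ℝ) ≤ n := n.cast_nonneg
  change -1 / 2 < (n : ℂ).re
  rw [Complex.natCast_re]
  linarith

/-- The monomial `x ^ n`, as an element of `L²[0,1]`. -/
def monomial (n : ℕ) : L2 := power ⟨(n : ℂ), natCast_mem n⟩

/-- The map `x ^ n ↦ c n * x ^ (p n)`, for all `n = 0, 1, 2, …`, extends to a bounded linear
operator on `L²[0,1]`. -/
def ExtendsBoundedly (c : ℕ → ℂ) (p : ℕ → halfPlane) : Prop :=
  ∃ T : L2 →L[ℂ] L2, ∀ n : ℕ, T (monomial n) = c n • power (p n)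

/-- The infinite matrix with entries `(p m + conj (p n) + 1) / (m + n + 1)`. -/
def pickMatrix (p : ℕ → halfPlane) : Matrix ℕ ℕ ℂ :=
  Matrix.of fun m n =>
    ((p m : ℂ) + (starRingEnd ℂ) (p n : ℂ) + 1) / ((m : ℂ) + (n : ℂ) + 1)

end MonomialOperator

end

/-! Everything rests on `⟪x^s, x^t⟫ = 1 / (conj s + t + 1)` and on the fact that a contraction with
prescribed values `u i ↦ v i` exists once `gram u - gram v` is positive semidefinite
(`exists_contraction_of_gram_le`).

Sufficiency in (a): let `K` be the transposed matrix and let `c` be its row 0 divided by `√(K 0 0)`.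
The difference of the two Gram matrices is then the entrywise product of a Schur complement of `K`
with the Gram matrix of the `x^(p n)`, so the Schur product theorem applies.

Necessity, and (b): identity minus the Hardy averaging operator is a contraction `D` with `D x^s =
s/(s+1) x^s`. Put `φ s = T x^s`. Whenever `c n ≠ 0`, `φ n` is an eigenvector of `D` with eigenvalue
`p n/(p n + 1)`. Parallelism of `D (φ s)` and `φ s` is a family of identities between products of
Mellin transforms. These pass from the integers to the whole half plane by the Weierstrass theorem
and analytic continuation (`inner_powerExt_mul_eq`). The eigenvalue is therefore a holomorphic
function of `s` bounded by `‖D‖ ≤ 1`. The Schwarz-Pick theorem in the variable `z = s/(s+1)` gives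
the required matrix up to a rank-one entrywise factor. -/

noncomputable section

namespace MonomialOperator

open scoped InnerProductSpace ComplexConjugate Matrix
open Filter Topology

/-! ### Positive semidefinite kernels, Gram matrices and Schur complements. -/

section PosSemidef

variable {ι : Type*}

theorem sum_sum_inner {E : Type*} [NormedAddCommGroup E] [InnerProductSpace ℂ E] (v : ι → E)
    (x : ι →₀ ℂ) :
    (x.sum fun i xi => x.sum fun j xj => star xi * ⟪v i, v j⟫_ℂ * xj) =
      ((‖Finsupp.linearCombination ℂ v x‖ ^ 2 : ℝ) : ℂ) := by
  have h : ((‖Finsupp.linearCombination ℂ v x‖ ^ 2 : ℝ) : ℂ) =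
      ⟪Finsupp.linearCombination ℂ v x, Finsupp.linearCombination ℂ v x⟫_ℂ := by
    rw [inner_self_eq_norm_sq_to_K, Complex.ofReal_pow]
    rfl
  rw [h, Finsupp.linearCombination_apply]
  simp only [Finsupp.sum, sum_inner, inner_sum, inner_smul_left, inner_smul_right, Finset.mul_sum]
  rw [Finset.sum_comm]
  refine Finset.sum_congr rfl fun i _ => Finset.sum_congr rfl fun j _ => ?_
  simp only [Complex.star_def]
  ring

theorem posSemidef_gram {E : Type*} [NormedAddCommGroup E] [InnerProductSpace ℂ E] (v : ι → E) :
    (Matrix.gram ℂ v).PosSemidef := by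
  refine ⟨Matrix.isHermitian_gram ℂ v, fun x => ?_⟩
  simp only [Matrix.gram_apply, sum_sum_inner]
  exact Complex.zero_le_real.2 (sq_nonneg _)

/-- The matrix of rank one with entries `a i * conj (a j)`. -/
theorem posSemidef_mul_conj (a : ι → ℂ) :
    (Matrix.of fun i j => a i * conj (a j)).PosSemidef := by
  have := posSemidef_gram (fun i => conj (a i))
  convert this using 1
  ext i j
  simp [Matrix.gram_apply, mul_comm]

/-- A Hermitian form takes real values, and the function-theoretic argument for Schwarz-Pick only
controls real parts. -/
theorem posSemidef_of_re_nonneg {M : Matrix ι ι ℂ} (hM : M.IsHermitian)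
    (h : ∀ x : ι →₀ ℂ, 0 ≤ (x.sum fun i xi => x.sum fun j xj => star xi * M i j * xj).re) :
    M.PosSemidef := by
  refine ⟨hM, fun x => ?_⟩
  rw [Complex.nonneg_iff]
  refine ⟨h x, ?_⟩
  symm
  rw [← Complex.conj_eq_iff_im]
  simp only [Finsupp.sum, map_sum]
  rw [Finset.sum_comm]
  refine Finset.sum_congr rfl fun i _ => ?_
  refine Finset.sum_congr rfl fun j _ => ?_
  have : conj (M j i) = M i j := hM.apply i j
  simp only [map_mul, this, Complex.star_def, Complex.conj_conj]
  ring

/-- Completing the square: the new form at `x` is the minimum of the form of `M` over all shifts of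
the `k`-th coordinate of `x`, attained at `-(∑ j, M k j * x j) / M k k`. -/
theorem PosSemidef.schurComplement {M : Matrix ι ι ℂ} (hM : M.PosSemidef) {k : ι}
    (hk : M k k ≠ 0) :
    (Matrix.of fun i j => M i j - M i k * M k j / M k k).PosSemidef := by
  have hs (i j : ι) : conj (M i j) = M j i := hM.1.apply j i
  refine ⟨?_, fun x => ?_⟩
  · ext i j
    simp [Matrix.conjTranspose_apply, hs, mul_comm]
  · have key := hM.2 (x + Finsupp.single k (-(x.sum fun j xj => M k j * xj) / M k k))
    set L := x.sum fun j xj => M k j * xj with hL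
    have hL' : (x.sum fun i xi => star xi * M i k) = conj L := by
      simp [hL, Finsupp.sum, hs, mul_comm]
    have e1 (i : ι) (xi : ℂ) : (x.sum fun j xj => star xi * M i j * xj) =
        star xi * x.sum fun j xj => M i j * xj := by
      simp [Finsupp.sum, Finset.mul_sum, mul_assoc]
    have e2 : (x.sum fun i xi => x.sum fun j xj => star xi * (M i j - M i k * M k j / M k k) * xj)
        = (x.sum fun i xi => x.sum fun j xj => star xi * M i j * xj) - conj L * L / M k k := by
      rw [← hL', hL]
      simp only [Finsupp.sum, Finset.sum_mul_sum, Finset.sum_div, ← Finset.sum_sub_distrib]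
      refine Finset.sum_congr rfl fun i _ => Finset.sum_congr rfl fun j _ => ?_
      ring
    simp only [Matrix.of_apply]
    rw [e2]
    convert key using 1
    rw [Finsupp.sum_add_index' (by simp) (by
      intro i a b
      simp only [star_add, add_mul, Finsupp.sum_add])]
    have e3 (i : ι) (xi : ℂ) (c : ℂ) :
        ((x + Finsupp.single k c).sum fun j xj => star xi * M i j * xj) =
        (x.sum fun j xj => star xi * M i j * xj) + star xi * M i k * c := by
      rw [Finsupp.sum_add_index' (by simp) (by intros; ring)]
      simp
    simp only [e3, Finsupp.sum_add]
    rw [Finsupp.sum_single_index (by simp), Finsupp.sum_single_index (by simp)]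
    have e4 (c : ℂ) : (x.sum fun i xi => star xi * M i k * c) = conj L * c := by
      rw [← hL']; simp [Finsupp.sum, Finset.sum_mul]
    rw [e4, e1 k, ← hL]
    simp only [Complex.star_def, map_div₀, map_neg, hs]
    field_simp
    ring

end PosSemidef

/-! ### Contractions from domination of Gram matrices. -/

section Extension

variable {ι E : Type*} [NormedAddCommGroup E] [InnerProductSpace ℂ E] [CompleteSpace E]

/-- If the Gram matrix of `v` is dominated by that of `u`, then some contraction maps each `u i` to
`v i`. -/
theorem exists_contraction_of_gram_le (u v : ι → E)
    (h : (Matrix.gram ℂ u - Matrix.gram ℂ v).PosSemidef) :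
    ∃ T : E →L[ℂ] E, (∀ x, ‖T x‖ ≤ ‖x‖) ∧ ∀ i, T (u i) = v i := by
  have hle (x : ι →₀ ℂ) :
      ‖Finsupp.linearCombination ℂ v x‖ ≤ ‖Finsupp.linearCombination ℂ u x‖ := by
    have := h.2 x
    simp only [Matrix.sub_apply, Matrix.gram_apply, mul_sub, sub_mul, Finsupp.sum_sub,
      sum_sum_inner] at this
    rw [← Complex.ofReal_sub, Complex.zero_le_real, sub_nonneg] at this
    exact le_of_sq_le_sq this (norm_nonneg _)
  let V := (LinearMap.range (Finsupp.linearCombination ℂ u)).topologicalClosure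
  have hV : IsClosed (V : Set E) := Submodule.isClosed_topologicalClosure _
  have : CompleteSpace V := hV.completeSpace_coe
  let e : (ι →₀ ℂ) →ₗ[ℂ] V := (Finsupp.linearCombination ℂ u).codRestrict V fun x =>
    Submodule.le_topologicalClosure _ ⟨x, rfl⟩
  have he : DenseRange e := by
    intro y
    rw [Topology.IsInducing.subtypeVal.closure_eq_preimage_closure_image]
    have hy : (y : E) ∈ closure (Set.range (Finsupp.linearCombination ℂ u)) := y.2
    convert hy using 1
    rw [← Set.range_comp]
    rfl
  let T₀ := (Finsupp.linearCombination ℂ v).extendOfNorm e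
  have hT₀ (x : V) : ‖T₀ x‖ ≤ ‖x‖ := by
    have := LinearMap.norm_extendOfNorm_apply_le (f := Finsupp.linearCombination ℂ v) he 1
      (fun x => by simpa using! hle x) x
    simpa using this
  -- Projecting first onto the closed span of the `u i` costs no norm and fixes each `u i`.
  refine ⟨T₀ ∘L V.orthogonalProjectionOnto, fun x => ?_, fun i => ?_⟩
  · exact (hT₀ _).trans (V.norm_orthogonalProjectionOnto_apply_le x)
  · have h1 : V.orthogonalProjectionOnto (u i) = e (Finsupp.single i 1) := by
      have : u i = (e (Finsupp.single i 1) : E) := by simp [e]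
      rw [this, Submodule.orthogonalProjectionOnto_mem_subspace_eq_self]
    have h2 : T₀ (e (Finsupp.single i 1)) = Finsupp.linearCombination ℂ v (Finsupp.single i 1) :=
      LinearMap.extendOfNorm_eq he ⟨1, fun x => by simpa using! hle x⟩ _
    rw [ContinuousLinearMap.comp_apply, h1, h2]
    simp

end Extension

/-! ### Inner products of powers, and sufficiency of the matrix condition. -/

section Power

theorem re_add_conj_add_one_pos (s t : halfPlane) : 0 < (conj (s : ℂ) + (t : ℂ) + 1).re := by
  have h1 : -1 / 2 < (s : ℂ).re := s.2
  have h2 : -1 / 2 < (t : ℂ).re := t.2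
  simp only [Complex.add_re, Complex.conj_re, Complex.one_re]
  linarith

theorem ne_zero_of_re_pos {z : ℂ} (h : 0 < z.re) : z ≠ 0 := by
  rintro rfl
  simp at h

theorem add_one_ne_zero (s : halfPlane) : (s : ℂ) + 1 ≠ 0 := by
  have h1 : -1 / 2 < (s : ℂ).re := s.2
  apply ne_zero_of_re_pos
  simp only [Complex.add_re, Complex.one_re]
  linarith

theorem coeFn_power (s : halfPlane) :
    power s =ᵐ[unitMeasure] fun x : ℝ => (x : ℂ) ^ (s : ℂ) :=
  (memLp_cpow s.2).coeFn_toLp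

theorem ae_unitMeasure_pos : ∀ᵐ x ∂unitMeasure, x ∈ Set.Ioc (0 : ℝ) 1 := by
  rw [unitMeasure, ← restrict_Ioc_eq_restrict_Icc]
  exact ae_restrict_mem measurableSet_Ioc

theorem inner_power (s t : halfPlane) :
    ⟪power s, power t⟫_ℂ = 1 / (conj (s : ℂ) + (t : ℂ) + 1) := by
  have hre := re_add_conj_add_one_pos s t
  rw [L2.inner_def]
  have h1 : ∀ᵐ x ∂unitMeasure, ⟪power s x, power t x⟫_ℂ = (x : ℂ) ^ (conj (s : ℂ) + (t : ℂ)) := by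
    filter_upwards [coeFn_power s, coeFn_power t, ae_unitMeasure_pos] with x hs ht hx
    have hx0 : (x : ℂ) ≠ 0 := by exact_mod_cast hx.1.ne'
    rw [hs, ht, RCLike.inner_apply, Complex.cpow_add _ _ hx0, mul_comm]
    congr 1
    rw [Complex.cpow_conj _ _ (by rw [Complex.arg_ofReal_of_nonneg hx.1.le]; exact Real.pi_pos.ne),
      Complex.conj_ofReal]
  rw [integral_congr_ae h1, unitMeasure, integral_Icc_eq_integral_Ioc,
    ← intervalIntegral.integral_of_le zero_le_one, integral_cpow]
  · have h0 : conj (s : ℂ) + (t : ℂ) + 1 ≠ 0 := ne_zero_of_re_pos hre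
    simp [Complex.zero_cpow h0]
  · left
    simp only [Complex.add_re, Complex.one_re] at hre ⊢
    linarith

/-- There is a contraction that multiplies every power `x ^ s` by `s / (s + 1)`. -/
theorem exists_contraction_power : ∃ D : L2 →L[ℂ] L2, (∀ x, ‖D x‖ ≤ ‖x‖) ∧
    ∀ s : halfPlane, D (power s) = ((s : ℂ) / ((s : ℂ) + 1)) • power s := by
  refine exists_contraction_of_gram_le _ _ ?_
  -- The Gram difference has rank one because `(conj s + 1)(t + 1) - conj s * t = conj s + t + 1`.
  convert posSemidef_mul_conj (fun s : halfPlane => 1 / (conj (s : ℂ) + 1)) using 1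
  ext s t
  have h1 := add_one_ne_zero s
  have h2 := add_one_ne_zero t
  have h3 : conj (s : ℂ) + 1 ≠ 0 := by simpa using (map_ne_zero (starRingEnd ℂ)).2 h1
  have h4 := ne_zero_of_re_pos (re_add_conj_add_one_pos s t)
  simp only [Matrix.sub_apply, Matrix.gram_apply, inner_smul_left, inner_smul_right, inner_power,
    Matrix.of_apply, map_div₀, map_add, map_one, Complex.conj_conj]
  field_simp
  ring

theorem exists_extendsBoundedly_of_posSemidef (p : ℕ → halfPlane) (h : (pickMatrix p).PosSemidef) :
    ∃ c : ℕ → ℂ, (∀ n, c n ≠ 0) ∧ ExtendsBoundedly c p := by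
  -- The transpose matches the inner product, which is conjugate-linear in its first slot.
  let K := (pickMatrix p)ᵀ
  have hK : K.PosSemidef := h.transpose
  have hKa (i j : ℕ) : K i j = (conj (p i : ℂ) + p j + 1) / ((i : ℂ) + j + 1) := by
    simp only [K, Matrix.transpose_apply, pickMatrix, Matrix.of_apply]
    congr 1 <;> ring
  have hnat (i j : ℕ) : (i : ℂ) + j + 1 ≠ 0 := by exact_mod_cast Nat.succ_ne_zero (i + j)
  have hp (i j : ℕ) := ne_zero_of_re_pos (re_add_conj_add_one_pos (p i) (p j))
  have hne (i j : ℕ) : K i j ≠ 0 := by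
    rw [hKa]
    exact div_ne_zero (hp i j) (hnat i j)
  have hpos : 0 ≤ K 0 0 := hK.diag_nonneg
  obtain ⟨r, hr⟩ : ∃ r : ℝ, (r : ℂ) * r = K 0 0 := by
    refine ⟨√(K 0 0).re, ?_⟩
    rw [← Complex.ofReal_mul, Real.mul_self_sqrt (Complex.nonneg_iff.1 hpos).1]
    exact (Complex.eq_re_of_ofReal_le hpos).symm
  have hr0 : (r : ℂ) ≠ 0 := by
    intro h0
    exact hne 0 0 (by rw [← hr, h0, zero_mul])
  refine ⟨fun n => K 0 n / r, fun n => div_ne_zero (hne 0 n) hr0, ?_⟩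
  -- Since `1/(i+j+1) = K i j / (conj (p i) + p j + 1)`, both Gram matrices contain the Gram matrix
  -- of the `power (p n)` as an entrywise factor.
  have hgram : Matrix.gram ℂ monomial - Matrix.gram ℂ (fun n => (K 0 n / r) • power (p n)) =
      (Matrix.of fun i j => K i j - K i 0 * K 0 j / K 0 0) ⊙
        Matrix.gram ℂ fun n => power (p n) := by
    ext i j
    have hs : conj (K 0 i) = K i 0 := hK.1.apply i 0
    have h1 := hnat i j
    have h2 := hp i j
    simp only [Matrix.sub_apply, Matrix.gram_apply, inner_smul_left, inner_smul_right, monomial,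
      inner_power, Matrix.of_apply, Matrix.hadamard_apply, map_div₀, hs, Complex.conj_natCast,
      Complex.conj_ofReal]
    rw [← hr, hKa i j]
    field_simp
  obtain ⟨T, -, hT⟩ := exists_contraction_of_gram_le monomial
    (fun n => (K 0 n / r) • power (p n))
    (hgram ▸ (PosSemidef.schurComplement hK (hne 0 0)).hadamard (posSemidef_gram _))
  exact ⟨T, hT⟩

end Power

/-! ### The Schwarz-Pick theorem on the disk, by Szegő kernels. -/

section Pick

variable {ι : Type*}

/-- The Cauchy integral formula in terms of the Szegő kernel of the circle of radius `r`. -/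
theorem circleAverage_mul_conj_szego {g : ℂ → ℂ} {r : ℝ} (hr : 0 < r)
    (hg : DiffContOnCl ℂ g (Metric.ball 0 r)) {z : ℂ} (hz : ‖z‖ < r) :
    Real.circleAverage (fun ζ => g ζ * conj (1 / ((r : ℂ) ^ 2 - ζ * conj z))) 0 r =
      g z / (r : ℂ) ^ 2 := by
  have hr0 : (r : ℂ) ≠ 0 := by exact_mod_cast hr.ne'
  have h := DiffContOnCl.circleAverage_smul_div (f := fun ζ => g ζ / (r : ℂ) ^ 2) (c := 0)
    (R := r) (w := z) (by
      rw [abs_of_pos hr]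
      exact ⟨hg.1.div_const _, hg.2.div_const _⟩)
    (by simpa [abs_of_pos hr] using hz)
  rw [← h]
  refine Real.circleAverage_congr_sphere fun ζ hζ => ?_
  have hζ' : ‖ζ‖ = r := by simpa [abs_of_pos hr] using hζ
  have hζ0 : ζ ≠ 0 := by
    rintro rfl
    simp only [norm_zero] at hζ'
    exact hr.ne hζ'
  have hζz : ζ - z ≠ 0 := by
    intro h0
    rw [sub_eq_zero] at h0
    rw [h0] at hζ'
    exact hz.ne hζ'
  have hconj : ζ * conj ζ = (r : ℂ) ^ 2 := by rw [Complex.mul_conj', hζ']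
  have hc0 : conj ζ ≠ 0 := (map_ne_zero _).2 hζ0
  simp only [map_div₀, map_one, map_sub, map_pow, Complex.conj_ofReal, map_mul, Complex.conj_conj,
    smul_eq_mul, sub_zero]
  -- On the circle `r² = ζ * conj ζ`, which turns the conjugated Szegő kernel into the Cauchy
  -- kernel.
  have hd : (r : ℂ) ^ 2 - conj ζ * z = conj ζ * (ζ - z) := by rw [← hconj]; ring
  rw [hd, ← hconj]
  field_simp

/-- The Schwarz-Pick inequality on a disk strictly inside the unit disk. -/
theorem pick_re_nonneg_of_lt {f : ℂ → ℂ} (hf : DifferentiableOn ℂ f (Metric.ball 0 1))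
    (hb : ∀ z ∈ Metric.ball (0 : ℂ) 1, ‖f z‖ ≤ 1) {r : ℝ} (hr : 0 < r) (hr1 : r < 1) (z : ι → ℂ)
    (x : ι → ℂ) (s : Finset ι) (hz : ∀ i ∈ s, ‖z i‖ < r) :
    0 ≤ (∑ i ∈ s, ∑ j ∈ s, star (x i) * ((1 - f (z i) * conj (f (z j))) /
      ((r : ℂ) ^ 2 - z i * conj (z j))) * x j).re := by
  let u : (ι → ℂ) → ℂ → ℂ := fun a ζ => ∑ j ∈ s, a j * (1 / ((r : ℂ) ^ 2 - ζ * conj (z j)))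
  -- These are the coefficients of the adjoint of multiplication by `f`, applied to the kernel
  -- combination `u x`; the claim is that this adjoint is a contraction.
  let y : ι → ℂ := fun j => x j * conj (f (z j))
  have hsub : Metric.closedBall (0 : ℂ) r ⊆ Metric.ball 0 1 := Metric.closedBall_subset_ball hr1
  have hden (ζ : ℂ) (hζ : ζ ∈ Metric.closedBall (0 : ℂ) r) (j : ι) (hj : j ∈ s) :
      (r : ℂ) ^ 2 - ζ * conj (z j) ≠ 0 := by
    intro h0
    have h1 : ‖ζ * conj (z j)‖ = r ^ 2 := by
      rw [← sub_eq_zero.1 h0, norm_pow, Complex.norm_real, Real.norm_of_nonneg hr.le]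
    rw [norm_mul, RCLike.norm_conj] at h1
    have h2 : ‖ζ‖ ≤ r := by simpa using hζ
    nlinarith [hz j hj, norm_nonneg ζ, norm_nonneg (z j)]
  have hu (a : ι → ℂ) : DifferentiableOn ℂ (u a) (Metric.closedBall 0 r) := by
    refine DifferentiableOn.fun_sum fun j hj => ?_
    refine (differentiableOn_const _).mul ((differentiableOn_const _).div ?_ ?_)
    · fun_prop
    · exact fun ζ hζ => hden ζ hζ j hj
  have hfd : DifferentiableOn ℂ f (Metric.closedBall 0 r) := hf.mono hsub
  have hdcl {g : ℂ → ℂ} (hg : DifferentiableOn ℂ g (Metric.closedBall 0 r)) :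
      DiffContOnCl ℂ g (Metric.ball 0 r) := by
    refine DifferentiableOn.diffContOnCl ?_
    rwa [closure_ball _ hr.ne']
  have hint {g : ℂ → ℂ} (hg : ContinuousOn g (Metric.closedBall 0 r)) : CircleIntegrable g 0 r :=
    (hg.mono Metric.sphere_subset_closedBall).circleIntegrable hr.le
  have hpair {g : ℂ → ℂ} (hg : DifferentiableOn ℂ g (Metric.closedBall 0 r)) (a : ι → ℂ) :
      Real.circleAverage (fun ζ => g ζ * conj (u a ζ)) 0 r =
        ∑ i ∈ s, conj (a i) * (g (z i) / (r : ℂ) ^ 2) := by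
    have h1 : (fun ζ => g ζ * conj (u a ζ)) = fun ζ => ∑ i ∈ s, conj (a i) •
        (g ζ * conj (1 / ((r : ℂ) ^ 2 - ζ * conj (z i)))) := by
      ext ζ
      simp only [u, map_sum, map_mul, Finset.mul_sum, smul_eq_mul]
      refine Finset.sum_congr rfl fun i _ => ?_
      ring
    have hk (i : ι) (hi : i ∈ s) : CircleIntegrable
        (fun ζ => conj (a i) • (g ζ * conj (1 / ((r : ℂ) ^ 2 - ζ * conj (z i))))) 0 r := by
      simp only [smul_eq_mul]
      refine hint (continuousOn_const.mul ?_)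
      refine hg.continuousOn.mul (Complex.continuous_conj.comp_continuousOn ?_)
      refine continuousOn_const.div (by fun_prop) fun ζ hζ => hden ζ hζ i hi
    rw [h1, Real.circleAverage_fun_sum hk]
    refine Finset.sum_congr rfl fun i hi => ?_
    rw [Real.circleAverage_fun_smul, circleAverage_mul_conj_szego hr (hdcl hg) (hz i hi),
      smul_eq_mul]
  have hcu (a : ι → ℂ) : ContinuousOn (fun ζ => conj (u a ζ)) (Metric.closedBall 0 r) :=
    Complex.continuous_conj.comp_continuousOn (hu a).continuousOn
  have hI1 : CircleIntegrable (fun ζ => u x ζ * conj (u x ζ)) 0 r :=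
    hint ((hu x).continuousOn.mul (hcu x))
  have hI2 : CircleIntegrable (fun ζ => f ζ * u y ζ * conj (u x ζ)) 0 r :=
    hint ((hfd.continuousOn.mul (hu y).continuousOn).mul (hcu x))
  have hI3 : CircleIntegrable (fun ζ => u y ζ * conj (u y ζ)) 0 r :=
    hint ((hu y).continuousOn.mul (hcu y))
  have hI12 : CircleIntegrable
      (fun ζ => u x ζ * conj (u x ζ) - f ζ * u y ζ * conj (u x ζ)) 0 r := hI1.sub hI2
  have hI122 : CircleIntegrable (fun ζ => u x ζ * conj (u x ζ) - f ζ * u y ζ * conj (u x ζ)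
      - f ζ * u y ζ * conj (u x ζ)) 0 r := hI12.sub hI2
  -- The cross term averages to the same value as `|u y|²`. Subtracting it twice thus leaves the
  -- average of `|u x|²` minus that of `|u y|²`.
  have havg : Real.circleAverage (fun ζ => u x ζ * conj (u x ζ) - f ζ * u y ζ * conj (u x ζ)
      - f ζ * u y ζ * conj (u x ζ) + u y ζ * conj (u y ζ)) 0 r =
      ∑ i ∈ s, conj (x i) * (u x (z i) / (r : ℂ) ^ 2) -
        ∑ i ∈ s, conj (y i) * (u y (z i) / (r : ℂ) ^ 2) := by
    rw [Real.circleAverage_fun_add hI122 hI3,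
      Real.circleAverage_fun_sub hI12 hI2, Real.circleAverage_fun_sub hI1 hI2,
      hpair (hu x), hpair (hu y), hpair (g := fun ζ => f ζ * u y ζ) (hfd.mul (hu y))]
    have : ∑ i ∈ s, conj (x i) * (f (z i) * u y (z i) / (r : ℂ) ^ 2) =
        ∑ i ∈ s, conj (y i) * (u y (z i) / (r : ℂ) ^ 2) := by
      refine Finset.sum_congr rfl fun i _ => ?_
      simp only [y, map_mul, Complex.conj_conj]
      ring
    rw [this]
    ring
  have hre : 0 ≤ (Real.circleAverage (fun ζ => u x ζ * conj (u x ζ) - f ζ * u y ζ * conj (u x ζ)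
      - f ζ * u y ζ * conj (u x ζ) + u y ζ * conj (u y ζ)) 0 r).re := by
    have := Complex.reCLM.circleAverage_comp_comm (hI122.add hI3)
    rw [Complex.reCLM_apply] at this
    refine le_of_le_of_eq ?_ this
    refine Real.circleAverage_nonneg_of_nonneg fun ζ hζ => ?_
    have hζ' : ζ ∈ Metric.closedBall (0 : ℂ) r := by
      rw [abs_of_pos hr] at hζ
      exact Metric.sphere_subset_closedBall hζ
    -- Since `‖f‖ ≤ 1`, the real part of the integrand is at least `(‖u x ζ‖ - ‖u y ζ‖)²`.
    have h1 : ‖f ζ * u y ζ * conj (u x ζ)‖ ≤ ‖u y ζ‖ * ‖u x ζ‖ := by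
      rw [norm_mul, norm_mul, RCLike.norm_conj]
      have := hb ζ (hsub hζ')
      gcongr
      nlinarith [norm_nonneg (u y ζ)]
    have h2 := Complex.re_le_norm (f ζ * u y ζ * conj (u x ζ))
    change 0 ≤ (u x ζ * conj (u x ζ) - f ζ * u y ζ * conj (u x ζ)
      - f ζ * u y ζ * conj (u x ζ) + u y ζ * conj (u y ζ)).re
    rw [Complex.mul_conj', Complex.mul_conj']
    simp only [Complex.add_re, Complex.sub_re, ← Complex.ofReal_pow, Complex.ofReal_re]
    nlinarith [sq_nonneg (‖u x ζ‖ - ‖u y ζ‖)]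
  rw [havg] at hre
  have hQ : ∑ i ∈ s, conj (x i) * (u x (z i) / (r : ℂ) ^ 2) -
        ∑ i ∈ s, conj (y i) * (u y (z i) / (r : ℂ) ^ 2) =
      ((r ^ 2)⁻¹ : ℝ) * ∑ i ∈ s, ∑ j ∈ s, star (x i) * ((1 - f (z i) * conj (f (z j))) /
      ((r : ℂ) ^ 2 - z i * conj (z j))) * x j := by
    simp only [u, y, Finset.sum_div, Finset.mul_sum, ← Finset.sum_sub_distrib, map_mul,
      Complex.conj_conj, Complex.star_def, Complex.ofReal_inv, Complex.ofReal_pow]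
    refine Finset.sum_congr rfl fun i _ => Finset.sum_congr rfl fun j _ => ?_
    ring
  rw [hQ, Complex.re_ofReal_mul] at hre
  exact nonneg_of_mul_nonneg_right hre (by positivity)

/-- The **Schwarz-Pick theorem** on the unit disk, for arbitrarily many points. -/
theorem posSemidef_pick {f : ℂ → ℂ} (hf : DifferentiableOn ℂ f (Metric.ball 0 1))
    (hb : ∀ z ∈ Metric.ball (0 : ℂ) 1, ‖f z‖ ≤ 1) (z : ι → ℂ) (hz : ∀ i, ‖z i‖ < 1) :
    (Matrix.of fun i j => (1 - f (z i) * conj (f (z j))) / (1 - z i * conj (z j))).PosSemidef := by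
  refine posSemidef_of_re_nonneg ?_ fun x => ?_
  · ext i j
    simp [Matrix.conjTranspose_apply, mul_comm]
  -- The unit circle is out of reach because `f` has no assumed boundary values; the inequality on
  -- radius `r` is passed to the limit `r → 1`.
  · have hlim : Tendsto (fun r : ℝ => (∑ i ∈ x.support, ∑ j ∈ x.support,
        star (x i) * ((1 - f (z i) * conj (f (z j))) / ((r : ℂ) ^ 2 - z i * conj (z j))) * x j).re)
        (𝓝[<] 1) (𝓝 (∑ i ∈ x.support, ∑ j ∈ x.support,
        star (x i) * ((1 - f (z i) * conj (f (z j))) /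
          (((1 : ℝ) : ℂ) ^ 2 - z i * conj (z j))) * x j).re) := by
      refine Tendsto.mono_left ?_ nhdsWithin_le_nhds
      refine (Complex.continuous_re.tendsto _).comp ?_
      refine tendsto_finsetSum _ fun i _ => tendsto_finsetSum _ fun j _ => ?_
      refine (Tendsto.const_mul _ (Tendsto.div tendsto_const_nhds ?_ ?_)).mul_const _
      · exact Continuous.tendsto (f := fun r : ℝ => (r : ℂ) ^ 2 - z i * conj (z j))
          (by fun_prop) 1
      · intro h0
        have h1 : ‖z i * conj (z j)‖ = 1 := by
          rw [← sub_eq_zero.1 h0]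
          simp
        rw [norm_mul, RCLike.norm_conj] at h1
        nlinarith [hz i, hz j, norm_nonneg (z i), norm_nonneg (z j)]
    have hev : ∀ᶠ r : ℝ in 𝓝[<] 1, 0 ≤ (∑ i ∈ x.support, ∑ j ∈ x.support,
        star (x i) * ((1 - f (z i) * conj (f (z j))) /
          ((r : ℂ) ^ 2 - z i * conj (z j))) * x j).re := by
      have h1 : ∀ᶠ r : ℝ in 𝓝[<] 1, ∀ i ∈ x.support, ‖z i‖ < r := by
        rw [Filter.eventually_all_finset]
        exact fun i _ => nhdsWithin_le_nhds (lt_mem_nhds (hz i))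
      have h2 : ∀ᶠ r : ℝ in 𝓝[<] 1, 0 < r := nhdsWithin_le_nhds (lt_mem_nhds zero_lt_one)
      filter_upwards [h1, h2, self_mem_nhdsWithin] with r hr h0 h1
      exact pick_re_nonneg_of_lt hf hb h0 h1 z x x.support hr
    have := ge_of_tendsto hlim hev
    simpa [Finsupp.sum] using this

end Pick

/-! ### Mellin transforms and their determination by integer points. -/

section Mellin

theorem isOpen_halfPlane : IsOpen halfPlane := isOpen_lt continuous_const Complex.continuous_re

theorem isPreconnected_halfPlane : IsPreconnected halfPlane :=
  (convex_halfSpace_re_gt (-1 / 2)).isPreconnected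

/-- The map `s ↦ x ^ s`, extended by zero outside the half plane. -/
def powerExt (s : ℂ) : L2 := by
  classical exact if hs : s ∈ halfPlane then power ⟨s, hs⟩ else 0

theorem powerExt_of_mem {s : ℂ} (hs : s ∈ halfPlane) : powerExt s = power ⟨s, hs⟩ := dif_pos hs

theorem powerExt_natCast (n : ℕ) : powerExt n = monomial n := powerExt_of_mem (natCast_mem n)

theorem inner_powerExt (a : L2) {s : ℂ} (hs : s ∈ halfPlane) :
    ⟪a, powerExt s⟫_ℂ = ∫ x, conj (a x) * (x : ℂ) ^ s ∂unitMeasure := by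
  rw [powerExt_of_mem hs, L2.inner_def]
  refine integral_congr_ae ?_
  filter_upwards [coeFn_power ⟨s, hs⟩] with x hx
  rw [hx, RCLike.inner_apply, mul_comm]

theorem memLp_conj (a : L2) : MemLp (fun x => conj (a x)) 2 unitMeasure :=
  (Lp.memLp a).star

theorem integrable_conj (a : L2) : Integrable (fun x => conj (a x)) unitMeasure :=
  (memLp_conj a).integrable one_le_two

/-- Differentiation under the integral sign. The distance from `s` to the boundary line is `3δ`: the
ball takes one `δ`, a second absorbs the logarithm through `|log x| * x^δ < 1/δ`, and the third
keeps `x^σ` square integrable. -/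
theorem differentiableOn_inner_powerExt (a : L2) :
    DifferentiableOn ℂ (fun s => ⟪a, powerExt s⟫_ℂ) halfPlane := by
  intro s hs
  refine DifferentiableAt.differentiableWithinAt ?_
  have hs' : -1 / 2 < s.re := hs
  let δ : ℝ := (s.re + 1 / 2) / 3
  have hδ : 0 < δ := by simp only [δ]; linarith
  let σ : ℝ := s.re - 2 * δ
  have hσ : (σ : ℂ) ∈ halfPlane := by
    change -1 / 2 < (σ : ℂ).re
    simp only [Complex.ofReal_re, σ, δ]
    linarith
  have hmeas (z : ℂ) : AEStronglyMeasurable (fun x : ℝ => conj (a x) * (x : ℂ) ^ z) unitMeasure :=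
    (memLp_conj a).1.mul (Complex.measurable_ofReal.pow_const z).aestronglyMeasurable
  have main := hasDerivAt_integral_of_dominated_loc_of_deriv_le (μ := unitMeasure) (x₀ := s)
    (F := fun z x => conj (a x) * (x : ℂ) ^ z)
    (F' := fun z x => conj (a x) * ((x : ℂ) ^ z * Complex.log x))
    (bound := fun x => δ⁻¹ * ‖conj (a x) * (x : ℂ) ^ (σ : ℂ)‖)
    (Metric.ball_mem_nhds s hδ) (Eventually.of_forall hmeas)
    ((memLp_conj a).integrable_mul (memLp_cpow hs))
    ((memLp_conj a).1.mul ((Complex.measurable_ofReal.pow_const s).mul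
      (Complex.measurable_log.comp Complex.measurable_ofReal)).aestronglyMeasurable)
    (by
      filter_upwards [ae_unitMeasure_pos] with x hx z hz
      have hre : s.re - δ < z.re := by
        have h1 := (Complex.abs_re_le_norm (z - s)).trans_lt (by simpa [dist_eq_norm] using hz)
        rw [Complex.sub_re] at h1
        linarith [(abs_lt.1 h1).1]
      have h2 : ‖(x : ℂ) ^ z * Complex.log x‖ ≤ δ⁻¹ * ‖(x : ℂ) ^ (σ : ℂ)‖ := by
        rw [norm_mul, Complex.norm_cpow_eq_rpow_re_of_pos hx.1,
          Complex.norm_cpow_eq_rpow_re_of_pos hx.1, ← Complex.ofReal_log hx.1.le,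
          Complex.norm_real, Complex.ofReal_re]
        have h3 := (Real.abs_log_mul_self_rpow_lt x δ hx.1 hx.2 hδ).le
        rw [abs_mul, abs_of_nonneg (Real.rpow_nonneg hx.1.le δ), one_div] at h3
        calc x ^ z.re * ‖Real.log x‖ ≤ x ^ (σ + δ) * ‖Real.log x‖ := by
              refine mul_le_mul_of_nonneg_right ?_ (norm_nonneg _)
              refine Real.rpow_le_rpow_of_exponent_ge hx.1 hx.2 ?_
              simp only [σ]
              linarith
          _ = (|Real.log x| * x ^ δ) * x ^ σ := by
              rw [Real.rpow_add hx.1, Real.norm_eq_abs]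
              ring
          _ ≤ δ⁻¹ * x ^ σ := mul_le_mul_of_nonneg_right h3 (Real.rpow_nonneg hx.1.le σ)
      rw [norm_mul, norm_mul (conj (a x))]
      calc ‖conj (a x)‖ * ‖(x : ℂ) ^ z * Complex.log x‖
          ≤ ‖conj (a x)‖ * (δ⁻¹ * ‖(x : ℂ) ^ (σ : ℂ)‖) := by gcongr
        _ = _ := by ring)
    (((memLp_conj a).integrable_mul (memLp_cpow hσ)).norm.const_mul _)
    (by
      filter_upwards [ae_unitMeasure_pos] with x hx z _
      have hx0 : (x : ℂ) ≠ 0 := by exact_mod_cast hx.1.ne'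
      have := ((hasDerivAt_id' z).const_cpow (c := (x : ℂ)) (Or.inl hx0)).const_mul (conj (a x))
      simpa using this)
  refine main.2.differentiableAt.congr_of_eventuallyEq ?_
  filter_upwards [isOpen_halfPlane.mem_nhds hs] with z hz
  exact inner_powerExt a hz

theorem analyticOnNhd_inner_powerExt (a : L2) :
    AnalyticOnNhd ℂ (fun s => ⟪a, powerExt s⟫_ℂ) halfPlane :=
  (differentiableOn_inner_powerExt a).analyticOnNhd isOpen_halfPlane

/-- A complex density all of whose moments vanish annihilates continuous functions. -/
theorem integral_mul_comp_eq_zero {Ω : Type*} [MeasurableSpace Ω] {ν : Measure Ω} {h : Ω → ℂ}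
    (hh : Integrable h ν) {m : Ω → ℝ} (hm : AEMeasurable m ν)
    (hm1 : ∀ᵐ z ∂ν, m z ∈ Set.Icc (0 : ℝ) 1)
    (h0 : ∀ n : ℕ, ∫ z, h z * (m z : ℂ) ^ n ∂ν = 0) {g : ℝ → ℝ} (hg : Continuous g) :
    ∫ z, h z * (g (m z) : ℂ) ∂ν = 0 := by
  have hint {q : ℝ → ℝ} (hq : Continuous q) : Integrable (fun z => h z * (q (m z) : ℂ)) ν := by
    obtain ⟨C, hC⟩ := isCompact_Icc.exists_bound_of_continuousOn
      (hq.continuousOn (s := Set.Icc (0 : ℝ) 1))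
    refine hh.mul_bdd (c := C) ?_ ?_
    · exact (Complex.measurable_ofReal.comp_aemeasurable
        (hq.measurable.comp_aemeasurable hm)).aestronglyMeasurable
    · filter_upwards [hm1] with z hz
      rw [Complex.norm_real]
      exact hC _ hz
  have hpoly (P : Polynomial ℝ) : ∫ z, h z * ((P.eval (m z) : ℝ) : ℂ) ∂ν = 0 := by
    have h1 (z : Ω) : h z * ((P.eval (m z) : ℝ) : ℂ) =
        ∑ n ∈ Finset.range (P.natDegree + 1), (P.coeff n : ℂ) * (h z * (m z : ℂ) ^ n) := by
      rw [Polynomial.eval_eq_sum_range]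
      push_cast
      rw [Finset.mul_sum]
      exact Finset.sum_congr rfl fun n _ => by ring
    simp only [h1]
    rw [integral_finsetSum]
    · refine Finset.sum_eq_zero fun n _ => ?_
      rw [integral_const_mul, h0, mul_zero]
    · intro n _
      have := (hint (continuous_pow n)).const_mul (P.coeff n : ℂ)
      simpa using this
  by_contra hne
  have hpos : 0 < ‖∫ z, h z * (g (m z) : ℂ) ∂ν‖ := norm_pos_iff.2 hne
  set I := ∫ z, ‖h z‖ ∂ν
  have hI : 0 ≤ I := integral_nonneg fun _ => norm_nonneg _
  -- Dividing by `I + 1` avoids the case `I = 0` and still makes the error strictly smaller than the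
  -- integral being approximated.
  obtain ⟨P, hP⟩ := exists_polynomial_near_of_continuousOn 0 1 g hg.continuousOn
    (‖∫ z, h z * (g (m z) : ℂ) ∂ν‖ / (I + 1)) (by positivity)
  have h1 : ∫ z, h z * (g (m z) : ℂ) ∂ν =
      ∫ z, (h z * (g (m z) : ℂ) - h z * ((P.eval (m z) : ℝ) : ℂ)) ∂ν := by
    rw [integral_sub (hint hg) (hint P.continuous), hpoly, sub_zero]
  have h2 : ‖∫ z, h z * (g (m z) : ℂ) ∂ν‖ ≤
      ∫ z, ‖h z‖ * (‖∫ z, h z * (g (m z) : ℂ) ∂ν‖ / (I + 1)) ∂ν := by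
    conv_lhs => rw [h1]
    refine norm_integral_le_of_norm_le (hh.norm.mul_const _) ?_
    filter_upwards [hm1] with z hz
    rw [← mul_sub, norm_mul, ← Complex.ofReal_sub, Complex.norm_real, Real.norm_eq_abs, abs_sub_comm]
    exact mul_le_mul_of_nonneg_left (hP _ hz).le (norm_nonneg _)
  rw [integral_mul_const, mul_div_assoc', le_div_iff₀ (by positivity)] at h2
  change _ ≤ I * _ at h2
  nlinarith

/-- The product of two Mellin transforms, as an integral over the square. -/
theorem inner_powerExt_mul (a b : L2) {s : ℂ} (hs : s ∈ halfPlane) :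
    ⟪a, powerExt s⟫_ℂ * ⟪b, powerExt s⟫_ℂ =
      ∫ z : ℝ × ℝ, conj (a z.1) * conj (b z.2) * ((z.1 * z.2 : ℝ) : ℂ) ^ s
        ∂(unitMeasure.prod unitMeasure) := by
  rw [inner_powerExt a hs, inner_powerExt b hs, ← integral_prod_mul]
  refine integral_congr_ae ?_
  filter_upwards [Measure.quasiMeasurePreserving_fst.ae ae_unitMeasure_pos,
    Measure.quasiMeasurePreserving_snd.ae ae_unitMeasure_pos] with z h1 h2
  rw [Complex.ofReal_mul, Complex.mul_cpow_ofReal_nonneg h1.1.le h2.1.le]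
  ring

/-- An identity between products of two Mellin transforms holds on the half plane as soon as it
holds at the natural numbers. -/
theorem inner_powerExt_mul_eq {a b c d : L2}
    (h : ∀ n : ℕ, ⟪a, monomial n⟫_ℂ * ⟪b, monomial n⟫_ℂ = ⟪c, monomial n⟫_ℂ * ⟪d, monomial n⟫_ℂ)
    {s : ℂ} (hs : s ∈ halfPlane) :
    ⟪a, powerExt s⟫_ℂ * ⟪b, powerExt s⟫_ℂ = ⟪c, powerExt s⟫_ℂ * ⟪d, powerExt s⟫_ℂ := by
  let ν := unitMeasure.prod unitMeasure
  have hi (a b : L2) : Integrable (fun z : ℝ × ℝ => conj (a z.1) * conj (b z.2)) ν :=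
    (integrable_conj a).mul_prod (integrable_conj b)
  have hm1 : ∀ᵐ z ∂ν, z.1 * z.2 ∈ Set.Icc (0 : ℝ) 1 := by
    filter_upwards [Measure.quasiMeasurePreserving_fst.ae ae_unitMeasure_pos,
      Measure.quasiMeasurePreserving_snd.ae ae_unitMeasure_pos] with z h1 h2
    exact ⟨mul_nonneg h1.1.le h2.1.le, mul_le_one₀ h1.2 h2.1.le h2.2⟩
  have hmul {s : ℝ} (hs : 0 ≤ s) (a b : L2) : Integrable
      (fun z : ℝ × ℝ => conj (a z.1) * conj (b z.2) * ((z.1 * z.2 : ℝ) : ℂ) ^ (s : ℂ)) ν := by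
    refine (hi a b).mul_bdd (c := 1) ?_ ?_
    · exact ((Complex.measurable_ofReal.comp (measurable_fst.mul measurable_snd)).pow_const
        (s : ℂ)).aestronglyMeasurable
    · filter_upwards [hm1] with z hz
      rw [← Complex.ofReal_cpow hz.1, Complex.norm_real,
        Real.norm_of_nonneg (Real.rpow_nonneg hz.1 s)]
      exact Real.rpow_le_one hz.1 hz.2 hs
  have hmem {s : ℝ} (hs : 0 ≤ s) : (s : ℂ) ∈ halfPlane := by
    change -1 / 2 < (s : ℂ).re
    rw [Complex.ofReal_re]
    linarith
  have hdiff {s : ℝ} (hs : 0 ≤ s) :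
      ⟪a, powerExt s⟫_ℂ * ⟪b, powerExt s⟫_ℂ - ⟪c, powerExt s⟫_ℂ * ⟪d, powerExt s⟫_ℂ =
      ∫ z : ℝ × ℝ, (conj (a z.1) * conj (b z.2) - conj (c z.1) * conj (d z.2)) *
        ((z.1 * z.2 : ℝ) : ℂ) ^ (s : ℂ) ∂ν := by
    rw [inner_powerExt_mul a b (hmem hs), inner_powerExt_mul c d (hmem hs),
      ← integral_sub (hmul hs a b) (hmul hs c d)]
    refine integral_congr_ae (Eventually.of_forall fun z => ?_)
    ring
  -- For real `s ≥ 0` the function `t ↦ t^s` is continuous on `[0,1]`, so vanishing of the integer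
  -- moments suffices.
  have hreal {s : ℝ} (hs : 0 ≤ s) :
      ⟪a, powerExt s⟫_ℂ * ⟪b, powerExt s⟫_ℂ = ⟪c, powerExt s⟫_ℂ * ⟪d, powerExt s⟫_ℂ := by
    rw [← sub_eq_zero, hdiff hs, ← integral_mul_comp_eq_zero ((hi a b).sub (hi c d))
      (measurable_fst.mul measurable_snd).aemeasurable hm1 ?_ (Real.continuous_rpow_const hs)]
    · refine integral_congr_ae ?_
      filter_upwards [hm1] with z hz
      simp only [Pi.sub_apply, Pi.mul_apply]
      rw [← Complex.ofReal_cpow hz.1]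
    · intro n
      have := hdiff n.cast_nonneg
      rw [Complex.ofReal_natCast, powerExt_natCast, h n, sub_self] at this
      rw [this]
      refine integral_congr_ae (Eventually.of_forall fun z => ?_)
      simp only [Pi.sub_apply, Pi.mul_apply, Complex.cpow_natCast]
  refine AnalyticOnNhd.eqOn_of_preconnected_of_frequently_eq (z₀ := 1)
    ((analyticOnNhd_inner_powerExt a).mul (analyticOnNhd_inner_powerExt b))
    ((analyticOnNhd_inner_powerExt c).mul (analyticOnNhd_inner_powerExt d))
    isPreconnected_halfPlane (by simpa using natCast_mem 1) ?_ hs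
  -- Nonnegative real exponents different from 1 and accumulating at 1 feed the identity theorem.
  have hlim : Tendsto (fun n : ℕ => ((1 + 1 / ((n : ℝ) + 1) : ℝ) : ℂ)) atTop (𝓝[≠] 1) := by
    refine tendsto_nhdsWithin_iff.2 ⟨?_, Eventually.of_forall fun n => ?_⟩
    · have := (tendsto_one_div_add_atTop_nhds_zero_nat (𝕜 := ℝ)).const_add 1
      rw [add_zero] at this
      exact_mod_cast (Complex.continuous_ofReal.tendsto 1).comp this
    · have : (0 : ℝ) < 1 / ((n : ℝ) + 1) := by positivity
      rw [Set.mem_compl_singleton_iff, ← Complex.ofReal_one, Ne, Complex.ofReal_inj]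
      linarith
  refine hlim.frequently (Eventually.frequently (Eventually.of_forall fun n => ?_))
  exact hreal (by positivity)

end Mellin

/-! ### The bounded holomorphic eigenvalue. -/

section Symbol

theorem power_ne_zero (s : halfPlane) : power s ≠ 0 := by
  intro h
  have h1 := inner_power s s
  rw [h, inner_zero_left] at h1
  exact one_div_ne_zero (ne_zero_of_re_pos (re_add_conj_add_one_pos s s)) h1.symm

/-- If a bounded operator maps `x ^ n` to `c n * x ^ p n`, then some holomorphic function on the half
plane bounded by one interpolates `p n / (p n + 1)` at all `n` with `c n ≠ 0`. -/
theorem exists_bounded_symbol {c : ℕ → ℂ} {p : ℕ → halfPlane} {T : L2 →L[ℂ] L2}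
    (hT : ∀ n, T (monomial n) = c n • power (p n)) {n₀ : ℕ} (hn₀ : c n₀ ≠ 0) :
    ∃ Θ : ℂ → ℂ, DifferentiableOn ℂ Θ halfPlane ∧ (∀ s ∈ halfPlane, ‖Θ s‖ ≤ 1) ∧
      ∀ n, c n ≠ 0 → Θ n = (p n : ℂ) / ((p n : ℂ) + 1) := by
  obtain ⟨D, hDle, hD⟩ := exists_contraction_power
  let φ : ℂ → L2 := fun s => T (powerExt s)
  have hφ (n : ℕ) : φ n = c n • power (p n) := by simp only [φ, powerExt_natCast, hT]
  have hDφ (n : ℕ) : D (φ n) = ((p n : ℂ) / ((p n : ℂ) + 1)) • φ n := by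
    rw [hφ, map_smul, hD, smul_comm]
  have hφ0 {n : ℕ} (hn : c n ≠ 0) : φ n ≠ 0 := by
    rw [hφ]
    exact smul_ne_zero hn (power_ne_zero _)
  have hadj (f : L2) (s : ℂ) : ⟪f, φ s⟫_ℂ = ⟪T.adjoint f, powerExt s⟫_ℂ :=
    (ContinuousLinearMap.adjoint_inner_left T _ _).symm
  have hadjD (f : L2) (s : ℂ) : ⟪f, D (φ s)⟫_ℂ = ⟪T.adjoint (D.adjoint f), powerExt s⟫_ℂ := by
    rw [ContinuousLinearMap.adjoint_inner_left, ContinuousLinearMap.adjoint_inner_left]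
  -- Cross-multiplying eliminates the eigenvalue, which is known only at integers.
  have hcross (f g : L2) {s : ℂ} (hs : s ∈ halfPlane) :
      ⟪f, D (φ s)⟫_ℂ * ⟪g, φ s⟫_ℂ = ⟪f, φ s⟫_ℂ * ⟪g, D (φ s)⟫_ℂ := by
    rw [hadj, hadj, hadjD, hadjD]
    refine inner_powerExt_mul_eq (fun n => ?_) hs
    rw [← powerExt_natCast, ← hadjD, ← hadjD, ← hadj, ← hadj, hDφ, inner_smul_right,
      inner_smul_right]
    ring
  -- This Rayleigh quotient is bounded everywhere, with value 0 where `φ s = 0`. Holomorphy is not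
  -- visible in it, as `φ s` also sits in the conjugate-linear slot; `hlam` replaces that entry by a
  -- fixed vector.
  let lam : ℂ → ℂ := fun s => ⟪φ s, D (φ s)⟫_ℂ / ⟪φ s, φ s⟫_ℂ
  have hlam (f : L2) {s : ℂ} (hs : s ∈ halfPlane) (hf : ⟪f, φ s⟫_ℂ ≠ 0) :
      lam s = ⟪f, D (φ s)⟫_ℂ / ⟪f, φ s⟫_ℂ := by
    have h0 : ⟪φ s, φ s⟫_ℂ ≠ 0 := by
      rw [inner_self_ne_zero]
      rintro h
      rw [h, inner_zero_right] at hf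
      exact hf rfl
    rw [div_eq_div_iff h0 hf, mul_comm _ ⟪φ s, φ s⟫_ℂ]
    exact hcross (φ s) f hs
  have hlam_le (s : ℂ) : ‖lam s‖ ≤ 1 := by
    simp only [lam]
    rw [norm_div, inner_self_eq_norm_sq_to_K, norm_pow]
    refine div_le_one_of_le₀ ((norm_inner_le_norm _ _).trans ?_) (by positivity)
    rw [RCLike.norm_ofReal, abs_norm, sq]
    exact mul_le_mul_of_nonneg_left (hDle _) (norm_nonneg _)
  have hdiff (f : L2) : DifferentiableOn ℂ (fun s => ⟪f, φ s⟫_ℂ) halfPlane := by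
    simp only [hadj]
    exact differentiableOn_inner_powerExt _
  have hdiffD (f : L2) : DifferentiableOn ℂ (fun s => ⟪f, D (φ s)⟫_ℂ) halfPlane := by
    simp only [hadjD]
    exact differentiableOn_inner_powerExt _
  have hlam_diff {s : ℂ} (hs : s ∈ halfPlane) (h0 : φ s ≠ 0) : DifferentiableAt ℂ lam s := by
    have hU : halfPlane ∈ 𝓝 s := isOpen_halfPlane.mem_nhds hs
    have h1 := (hdiff (φ s)).differentiableAt hU
    have h2 := (hdiffD (φ s)).differentiableAt hU
    have h3 : ⟪φ s, φ s⟫_ℂ ≠ 0 := inner_self_ne_zero.2 h0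
    refine (h2.div h1 h3).congr_of_eventuallyEq ?_
    filter_upwards [hU, h1.continuousAt.eventually_ne h3] with z hz hz0
    exact hlam (φ s) hz hz0
  -- Zeros of `φ` are zeros of the holomorphic function `⟪φ n₀, φ s⟫`, which is nonzero at `n₀`.
  have hisol {s : ℂ} (hs : s ∈ halfPlane) : ∀ᶠ z in 𝓝[≠] s, φ z ≠ 0 := by
    have han := (hdiff (φ n₀)).analyticOnNhd isOpen_halfPlane
    rcases (han s hs).eventually_eq_zero_or_eventually_ne_zero with h | h
    · exact absurd (han.eqOn_zero_of_preconnected_of_eventuallyEq_zero isPreconnected_halfPlane hs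
        h (natCast_mem n₀)) (inner_self_ne_zero.2 (hφ0 hn₀))
    · filter_upwards [h] with z hz h0
      exact hz (by rw [h0, inner_zero_right])
  -- Boundedness of `lam` makes the zeros of `φ` removable singularities; the limit fills them in.
  let Θ : ℂ → ℂ := fun s => limUnder (𝓝[≠] s) lam
  have hΘ {s : ℂ} (hs : s ∈ halfPlane) (h0 : φ s ≠ 0) : Θ s = lam s :=
    ((hlam_diff hs h0).continuousAt.tendsto.mono_left nhdsWithin_le_nhds).limUnder_eq
  have hΘ_diff {s : ℂ} (hs : s ∈ halfPlane) :
      DifferentiableAt ℂ (Function.update lam s (Θ s)) s ∧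
        Θ =ᶠ[𝓝 s] Function.update lam s (Θ s) := by
    have hU : {z | z ≠ s → z ∈ halfPlane ∧ φ z ≠ 0} ∈ 𝓝 s := by
      have hmem : ∀ᶠ z in 𝓝[≠] s, z ∈ halfPlane :=
        nhdsWithin_le_nhds (isOpen_halfPlane.mem_nhds hs)
      exact eventually_nhdsWithin_iff.1 (hmem.and (hisol hs))
    refine ⟨?_, ?_⟩
    · refine (Complex.differentiableOn_update_limUnder_of_bddAbove hU (fun z hz => ?_)
        ⟨1, ?_⟩).differentiableAt hU
      · have := hz.1 hz.2
        exact (hlam_diff this.1 this.2).differentiableWithinAt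
      · rintro _ ⟨z, -, rfl⟩
        exact hlam_le z
    · filter_upwards [hU] with z hz
      rcases eq_or_ne z s with rfl | hne
      · simp
      · rw [Function.update_of_ne hne]
        exact hΘ (hz hne).1 (hz hne).2
  refine ⟨Θ, fun s hs => ?_, fun s hs => ?_, fun n hn => ?_⟩
  · have := hΘ_diff hs
    exact (this.1.congr_of_eventuallyEq this.2).differentiableWithinAt
  · have := continuousAt_update_same.1 (hΘ_diff hs).1.continuousAt
    exact le_of_tendsto this.norm (Eventually.of_forall hlam_le)
  · rw [hΘ (natCast_mem n) (hφ0 hn)]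
    simp only [lam]
    rw [hDφ, inner_smul_right, mul_div_cancel_right₀ _ (inner_self_ne_zero.2 (hφ0 hn))]

end Symbol

/-! ### Necessity of the matrix condition. -/

section PickMatrix

/-- The inverse of `s ↦ s/(s+1)`, with `Re (z/(1-z)) + 1/2 = (1 - |z|²) / (2 |1-z|²)`. -/
theorem div_one_sub_mem_halfPlane {z : ℂ} (hz : ‖z‖ < 1) : z / (1 - z) ∈ halfPlane := by
  have h0 : 1 - z ≠ 0 := by
    intro h
    rw [← sub_eq_zero.1 h, norm_one] at hz
    exact lt_irrefl _ hz
  have h1 : Complex.normSq z < 1 := by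
    rw [Complex.normSq_eq_norm_sq]
    nlinarith [norm_nonneg z]
  have h2 : 0 < Complex.normSq (1 - z) := Complex.normSq_pos.2 h0
  change -1 / 2 < (z / (1 - z)).re
  rw [Complex.div_re, ← add_div, div_lt_div_iff₀ two_pos h2]
  simp only [Complex.normSq_apply, Complex.sub_re, Complex.sub_im, Complex.one_re,
    Complex.one_im] at h1 ⊢
  nlinarith

theorem posSemidef_submatrix_pickMatrix {c : ℕ → ℂ} {p : ℕ → halfPlane}
    (h : ExtendsBoundedly c p) :
    ((pickMatrix p).submatrix (Subtype.val : {n : ℕ // c n ≠ 0} → ℕ)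
      (Subtype.val : {n : ℕ // c n ≠ 0} → ℕ)).PosSemidef := by
  obtain ⟨T, hT⟩ := h
  rcases isEmpty_or_nonempty {n : ℕ // c n ≠ 0} with hempty | ⟨⟨n₀, hn₀⟩⟩
  · exact ⟨Subsingleton.elim _ _, fun x => by simp [Subsingleton.elim x 0]⟩
  obtain ⟨Θ, hΘ, hΘ1, hΘp⟩ := exists_bounded_symbol hT hn₀
  have hmaps (z : ℂ) (hz : z ∈ Metric.ball (0 : ℂ) 1) : z / (1 - z) ∈ halfPlane :=
    div_one_sub_mem_halfPlane (by simpa using hz)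
  have hne (n : ℕ) : (n : ℂ) + 1 ≠ 0 := by exact_mod_cast n.succ_ne_zero
  have hf : DifferentiableOn ℂ (fun z => Θ (z / (1 - z))) (Metric.ball 0 1) := by
    refine hΘ.comp (differentiableOn_id.div (by fun_prop) fun z hz h0 => ?_) hmaps
    rw [mem_ball_zero_iff, ← sub_eq_zero.1 h0, norm_one] at hz
    exact lt_irrefl _ hz
  have hpick := posSemidef_pick hf (fun z hz => hΘ1 _ (hmaps z hz))
    (fun n : {n : ℕ // c n ≠ 0} => (n : ℂ) / ((n : ℂ) + 1)) (fun n => by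
      have h1 : (n : ℂ) / ((n : ℂ) + 1) = (((n : ℕ) / ((n : ℕ) + 1) : ℝ) : ℂ) := by push_cast; rfl
      rw [h1, Complex.norm_real, Real.norm_of_nonneg (by positivity), div_lt_one (by positivity)]
      exact lt_add_one _)
  have hval (n : {n : ℕ // c n ≠ 0}) :
      Θ ((n : ℂ) / ((n : ℂ) + 1) / (1 - (n : ℂ) / ((n : ℂ) + 1))) =
        (p n : ℂ) / ((p n : ℂ) + 1) := by
    rw [← hΘp n n.2]
    congr 1
    have := hne n
    have h1 : 1 - (n : ℂ) / ((n : ℂ) + 1) = 1 / ((n : ℂ) + 1) := by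
      field_simp
      ring
    rw [h1]
    field_simp
  -- The identity `1 - s/(s+1) * t/(t+1) = (s+t+1)/((s+1)(t+1))`, used for both nodes and values,
  -- leaves a rank-one factor to clear.
  have key : (pickMatrix p).submatrix (Subtype.val : {n : ℕ // c n ≠ 0} → ℕ) Subtype.val =
      (Matrix.of fun i j : {n : ℕ // c n ≠ 0} =>
        (1 - Θ ((i : ℂ) / ((i : ℂ) + 1) / (1 - (i : ℂ) / ((i : ℂ) + 1))) *
          conj (Θ ((j : ℂ) / ((j : ℂ) + 1) / (1 - (j : ℂ) / ((j : ℂ) + 1))))) /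
        (1 - (i : ℂ) / ((i : ℂ) + 1) * conj ((j : ℂ) / ((j : ℂ) + 1)))) ⊙
      Matrix.of fun i j : {n : ℕ // c n ≠ 0} =>
        ((p i : ℂ) + 1) / ((i : ℂ) + 1) * conj (((p j : ℂ) + 1) / ((j : ℂ) + 1)) := by
    ext i j
    have h1 := add_one_ne_zero (p i)
    have h2 : conj (p j : ℂ) + 1 ≠ 0 := by
      simpa using (map_ne_zero (starRingEnd ℂ)).2 (add_one_ne_zero (p j))
    have h3 := hne i
    have h4 := hne j
    have h5 : (i : ℂ) + (j : ℂ) + 1 ≠ 0 := by exact_mod_cast Nat.succ_ne_zero ((i : ℕ) + j)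
    have e1 : 1 - (i : ℂ) / ((i : ℂ) + 1) * ((j : ℂ) / ((j : ℂ) + 1)) =
        ((i : ℂ) + (j : ℂ) + 1) / (((i : ℂ) + 1) * ((j : ℂ) + 1)) := by
      field_simp
      ring
    have e2 : 1 - (p i : ℂ) / ((p i : ℂ) + 1) * (conj (p j : ℂ) / (conj (p j : ℂ) + 1)) =
        ((p i : ℂ) + conj (p j : ℂ) + 1) / (((p i : ℂ) + 1) * (conj (p j : ℂ) + 1)) := by
      field_simp
      ring
    simp only [Matrix.submatrix_apply, pickMatrix, Matrix.of_apply, Matrix.hadamard_apply, hval,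
      map_div₀, map_add, map_one, Complex.conj_natCast]
    rw [e1, e2]
    field_simp
  rw [key]
  exact hpick.hadamard (posSemidef_mul_conj _)

end PickMatrix

end MonomialOperator

end

theorem corollary1p7 (p : ℕ → MonomialOperator.halfPlane) :
    ((∃ c : ℕ → ℂ, (∀ n, c n ≠ 0) ∧ MonomialOperator.ExtendsBoundedly c p) ↔
      (MonomialOperator.pickMatrix p).PosSemidef) ∧
    (∀ c : ℕ → ℂ, MonomialOperator.ExtendsBoundedly c p →
      ((MonomialOperator.pickMatrix p).submatrix
        (Subtype.val : {n : ℕ // c n ≠ 0} → ℕ)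
        (Subtype.val : {n : ℕ // c n ≠ 0} → ℕ)).PosSemidef) := by
  refine ⟨⟨?_, MonomialOperator.exists_extendsBoundedly_of_posSemidef p⟩,
    fun c => MonomialOperator.posSemidef_submatrix_pickMatrix⟩
  rintro ⟨c, hc, h⟩
  exact (MonomialOperator.posSemidef_submatrix_pickMatrix h).submatrix fun n => ⟨n, hc n⟩
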